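/- Let $K\subset S^3$ be a knot with knot group $G(K)=\pi_1(S^3\setminus K)$, fix an isomorphism $G(K)/[G(K),G(K)]\cong\mathbb Z=\langle t\rangle$, let $\alpha:G(K)\to\langle t\rangle$ be the resulting epimorphism and $\alpha_*:\mathbb Z G(K)\to\mathbb Z[t,t^{-1}]$ the induced ring homomorphism. For a finite presentation $P=\langle x_1,\dots,x_n\mid r_1,\dots,r_m\rangle$ of $G(K)$, with any number $m$ of relators, let $$A=\Bigl(\alpha_*\Bigl(\frac{\partial r_i}{\partial x_j}\Bigr)\Bigr)_{1\le i\le m,\ 1\le j\le n}$$ be its Alexander matrix, where $\partial/\partial x_j:\mathbb Z F_n\to\mathbb Z F_n$ are Fox's free differentials and $\mathbb ZF_n$ is mapped to $\mathbb ZG(K)$ by the presentation. Let $A_k$ be the $m\times(n-1)$ matrix obtained from $A$ by removing the $k$-th column, and let $Q_k\in\mathbb Z[t,t^{-1}]$ be a greatest common divisor of the maximal minors of $A_k$, that is, of the determinants of all its square submatrices of size $\min(m,n-1)$. Then for every such $P$ there is a $k$ with $\alpha_*(x_k)-1\ne 0$, the greatest common divisor $Q_k$ exists for every $k$, and, up to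 a factor $\pm t^s$ $(s\in\mathbb Z)$, the rational expression $$\frac{Q_k}{\alpha_*(x_k)-1}\in\mathbb Q(t)$$ depends neither on the index $k$ with $\alpha_*(x_k)-1\neq0$ nor on the finite presentation $P$ of $G(K)$. Namely, it is an invariant of the group up to $\pm t^s$: if $\varphi:G(K)\to H$ is an isomorphism of groups and $\beta:H\to\langle t\rangle$ is an epimorphism that induces an isomorphism $H/[H,H]\cong\langle t\rangle$ and satisfies $\beta\circ\varphi=\alpha$, then any finite presentation of $H$ gives, by means of $\beta$, the same rational expression up to $\pm t^s$. -/

import Mathlib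

open scoped LaurentPolynomial

noncomputable section

/-! ### Knots and knot groups -/

/-- The `3`-sphere, as the unit sphere of Euclidean `4`-space. -/
abbrev ThreeSphere : Type :=
  Metric.sphere (0 : EuclideanSpace ℝ (Fin 4)) 1

/-- A knot: a subset of `S³` that is the image of a topological embedding of the circle. -/
def IsKnot (K : Set ThreeSphere) : Prop :=
  ∃ f : Circle → ThreeSphere, Topology.IsEmbedding f ∧ Set.range f = K

/-- The knot group `G(K) = π₁(S³ - K, x₀)`. -/
abbrev KnotGroup (K : Set ThreeSphere) (x₀ : (Kᶜ : Set ThreeSphere)) : Type :=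
  FundamentalGroup (Kᶜ : Set ThreeSphere) x₀

/-! ### Finite presentations -/

/-- A finite presentation `G = ⟨x₁, …, xₙ | r₁, …, rₘ⟩` of a group `G`: generators `gen j ∈ G` and
relators `rel i` in the free group, such that the induced homomorphism `Fₙ → G` is onto and its
kernel is the normal closure of the relators. -/
structure FinitePresentation (G : Type*) [Group G] where
  /-- the number of generators -/
  n : ℕ
  /-- the number of relators -/
  m : ℕ
  /-- the generators, as elements of the group -/
  gen : Fin n → G
  /-- the relators, as elements of the free group -/
  rel : Fin m → FreeGroup (Fin n)
  lift_surjective : Function.Surjective (FreeGroup.lift gen)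
  ker_lift : (FreeGroup.lift gen).ker = Subgroup.normalClosure (Set.range rel)

/-! ### Fox's free differentials -/

section Fox

variable {ι : Type*}

/-- The letter `xᵢ` or `xᵢ⁻¹` in the integral group ring of the free group. -/
def foxLetter (p : ι × Bool) : MonoidAlgebra ℤ (FreeGroup ι) :=
  MonoidAlgebra.of ℤ (FreeGroup ι) (FreeGroup.mk [p])

theorem foxLetter_mul_not (i : ι) (b : Bool) : foxLetter (i, b) * foxLetter (i, !b) = 1 := by
  rw [foxLetter, foxLetter, ← map_mul, FreeGroup.mul_mk,
    show FreeGroup.mk ([(i, b)] ++ [(i, !b)]) = (1 : FreeGroup ι) from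
      Quot.sound FreeGroup.Red.Step.cons_not, map_one]

variable [DecidableEq ι]

/-- The free differential `∂/∂xⱼ` of a letter: `∂xⱼ/∂xⱼ = 1`, `∂xⱼ⁻¹/∂xⱼ = -xⱼ⁻¹`,
and `0` for the other letters. -/
def foxOfLetter (j : ι) (p : ι × Bool) : MonoidAlgebra ℤ (FreeGroup ι) :=
  if p.1 = j then (if p.2 then 1 else -foxLetter p) else 0

/-- The free differential `∂/∂xⱼ` of a word, not necessarily reduced, by the product rule. -/
def foxOfWord (j : ι) : List (ι × Bool) → MonoidAlgebra ℤ (FreeGroup ι)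
  | [] => 0
  | p :: w => foxOfLetter j p + foxLetter p * foxOfWord j w

theorem foxOfWord_append (j : ι) (u v : List (ι × Bool)) :
    foxOfWord j (u ++ v) =
      foxOfWord j u + MonoidAlgebra.of ℤ (FreeGroup ι) (FreeGroup.mk u) * foxOfWord j v := by
  induction u with
  | nil =>
    have h : MonoidAlgebra.of ℤ (FreeGroup ι) (FreeGroup.mk []) = 1 := map_one _
    rw [h, List.nil_append, one_mul]
    simp [foxOfWord]
  | cons p u ih =>
    have h : MonoidAlgebra.of ℤ (FreeGroup ι) (FreeGroup.mk (p :: u)) =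
        foxLetter p * MonoidAlgebra.of ℤ (FreeGroup ι) (FreeGroup.mk u) := by
      rw [foxLetter, ← map_mul, FreeGroup.mul_mk, List.singleton_append]
    rw [h, List.cons_append, foxOfWord, foxOfWord, ih, mul_add, mul_assoc, add_assoc]

theorem foxOfWord_step (j : ι) (u v : List (ι × Bool)) (h : FreeGroup.Red.Step u v) :
    foxOfWord j u = foxOfWord j v := by
  obtain @⟨L₁, L₂, i, b⟩ := h
  have key : foxOfWord j ((i, b) :: (i, !b) :: L₂) = foxOfWord j L₂ := by
    have h1 := foxLetter_mul_not i b
    simp only [foxOfWord, mul_add, ← mul_assoc, h1, one_mul, ← add_assoc]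
    by_cases hij : i = j <;> cases b <;> simp_all [foxOfLetter]
  rw [foxOfWord_append, key, ← foxOfWord_append]

/-- The free differential `∂/∂xⱼ` on the elements of the free group. -/
def foxOfGroup (j : ι) (g : FreeGroup ι) : MonoidAlgebra ℤ (FreeGroup ι) :=
  Quot.lift (foxOfWord j) (foxOfWord_step j) g

/-- Fox's free differential `∂/∂xⱼ : ℤFₙ → ℤFₙ`, the `ℤ`-linear extension of `foxOfGroup`. -/
def foxDeriv (j : ι) : MonoidAlgebra ℤ (FreeGroup ι) →+ MonoidAlgebra ℤ (FreeGroup ι) :=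
  MonoidAlgebra.liftNC (Int.castAddHom (MonoidAlgebra ℤ (FreeGroup ι))) (foxOfGroup j)

theorem foxDeriv_of (j : ι) (g : FreeGroup ι) :
    foxDeriv j (MonoidAlgebra.of ℤ (FreeGroup ι) g) = foxOfGroup j g := by
  simp [foxDeriv]

/-- `∂xᵢ/∂xⱼ = δᵢⱼ`. -/
theorem foxDeriv_generator (i j : ι) :
    foxDeriv j (MonoidAlgebra.of ℤ (FreeGroup ι) (FreeGroup.of i)) = if i = j then 1 else 0 := by
  rw [foxDeriv_of]
  change foxOfWord j [(i, true)] = _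
  simp [foxOfWord, foxOfLetter]

/-- `∂(gg')/∂xⱼ = ∂g/∂xⱼ + g ∂g'/∂xⱼ` for `g`, `g'` in the free group. -/
theorem foxDeriv_mul (j : ι) (g g' : FreeGroup ι) :
    foxDeriv j (MonoidAlgebra.of ℤ (FreeGroup ι) (g * g')) =
      foxDeriv j (MonoidAlgebra.of ℤ (FreeGroup ι) g) +
        MonoidAlgebra.of ℤ (FreeGroup ι) g *
          foxDeriv j (MonoidAlgebra.of ℤ (FreeGroup ι) g') := by
  rw [foxDeriv_of, foxDeriv_of, foxDeriv_of]
  induction g using Quot.ind with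
  | mk u =>
    induction g' using Quot.ind with
    | mk v => exact foxOfWord_append j u v

end Fox

/-! ### The Alexander matrix and its maximal minors -/

section Alexander

variable {G : Type*} [Group G]

/-- The ring homomorphism `α_* : ℤG → ℤ[t, t⁻¹]` induced by `G → G/[G,G] ≅ ⟨t⟩`, where the infinite
cyclic group `⟨t⟩` is `Multiplicative ℤ`. -/
def alphaStar (α : Abelianization G ≃* Multiplicative ℤ) : MonoidAlgebra ℤ G →+* ℤ[T;T⁻¹] :=
  (MonoidAlgebra.lift ℤ ℤ[T;T⁻¹] G
    ((AddMonoidAlgebra.of ℤ ℤ).comp (α.toMonoidHom.comp Abelianization.of))).toRingHom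

namespace FinitePresentation

variable (P : FinitePresentation G) (α : Abelianization G ≃* Multiplicative ℤ)

/-- The ring homomorphism `ℤFₙ → ℤG` induced by `Fₙ → G`. -/
def proj : MonoidAlgebra ℤ (FreeGroup (Fin P.n)) →+* MonoidAlgebra ℤ G :=
  MonoidAlgebra.mapDomainRingHom ℤ (FreeGroup.lift P.gen)

/-- The Alexander matrix `A = (α_*(∂rᵢ/∂xⱼ))`, one row for each relator and one column for each
generator. -/
def alexanderMatrix : Matrix (Fin P.m) (Fin P.n) ℤ[T;T⁻¹] :=
  Matrix.of fun i j =>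
    alphaStar α (P.proj (foxDeriv j (MonoidAlgebra.of ℤ (FreeGroup (Fin P.n)) (P.rel i))))

/-- The matrix `A_k`: the Alexander matrix with its `k`-th column removed. -/
def alexanderMatrixRemove (k : Fin P.n) : Matrix (Fin P.m) {j : Fin P.n // j ≠ k} ℤ[T;T⁻¹] :=
  (P.alexanderMatrix α).submatrix id Subtype.val

/-- The maximal minors of the `m × (n - 1)` matrix `A_k`: the determinants of its square submatrices
of size `min m (n - 1)`. -/
def maximalMinors (k : Fin P.n) : Set ℤ[T;T⁻¹] :=
  {D | ∃ (r : Fin (min P.m (P.n - 1)) ↪o Fin P.m)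
      (c : Fin (min P.m (P.n - 1)) ↪o {j : Fin P.n // j ≠ k}),
      D = ((P.alexanderMatrixRemove α k).submatrix r c).det}

/-- `Q` is a greatest common divisor `Q_k` of the maximal minors of `A_k` in `ℤ[t, t⁻¹]`
(such a `Q` is unique up to a unit). -/
def IsAlexanderGCD (k : Fin P.n) (Q : ℤ[T;T⁻¹]) : Prop :=
  (∀ D ∈ P.maximalMinors α k, Q ∣ D) ∧
    ∀ E : ℤ[T;T⁻¹], (∀ D ∈ P.maximalMinors α k, E ∣ D) → E ∣ Q

/-- The element `α_*(x_k) - 1` of `ℤ[t, t⁻¹]`. -/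
def denominator (k : Fin P.n) : ℤ[T;T⁻¹] :=
  alphaStar α (MonoidAlgebra.of ℤ G (P.gen k)) - 1

/-- The rational expression `Q / (α_*(x_k) - 1)`, in the field of fractions of `ℤ[t, t⁻¹]`. -/
def rationalExpression (k : Fin P.n) (Q : ℤ[T;T⁻¹]) : FractionRing ℤ[T;T⁻¹] :=
  algebraMap ℤ[T;T⁻¹] (FractionRing ℤ[T;T⁻¹]) Q /
    algebraMap ℤ[T;T⁻¹] (FractionRing ℤ[T;T⁻¹]) (P.denominator α k)

end FinitePresentation

/-- Equality of two rational expressions up to a factor `± tˢ`, `s ∈ ℤ`. -/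
def EqUpToUnit (a b : FractionRing ℤ[T;T⁻¹]) : Prop :=
  ∃ (ε : ℤˣ) (s : ℤ),
    a = algebraMap ℤ[T;T⁻¹] (FractionRing ℤ[T;T⁻¹])
      (LaurentPolynomial.C (ε : ℤ) * LaurentPolynomial.T s) * b

end Alexander

end

/-! The Alexander matrix presents a module that depends only on the group and `α`: the target of the
universal crossed homomorphism `d(gh) = d(g) + α(g) d(h)`. Two presentations therefore give
canonically isomorphic modules (`alexanderLift_comp`), and no Tietze moves are needed. The ideal of
`(n - 1)`-minors of `A` is the first Fitting ideal of this module, hence an invariant, and so is its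
greatest common divisor `Δ` up to units.

It remains to compare `Q_k` with `Δ`. Put `u_j = α_*(x_j) - 1`. Fox's fundamental formula gives `A u
= 0`, so by Cramer's rule minors omitting different columns are proportional to the corresponding
`u_j` up to sign (`mul_minor_eq_neg`). Since `α` is onto, the `u_j` generate the ideal `(t - 1)`,
whence `Q_k (t - 1) ∼ Δ u_k` (`associated_mul_gcd`), that is, `Q_k / u_k ∼ Δ / (t - 1)`.

Maximal minors do have size `n - 1`, because infinite cyclic abelianization forces `n ≤ m + 1`
(`n_le_m_add_one`). Finally `ℤ[t, t⁻¹]` is factorial with units `± tˢ`. -/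

noncomputable section

/-! ### Ideals of minors and Fitting ideals -/

section Minors

variable {R : Type*} [CommRing R] {ι κ M M' : Type*}

/-- The ideal generated by the `k × k` minors of all matrices whose rows lie in `N`. -/
def minorsIdeal (k : ℕ) (N : Submodule R (ι → R)) : Ideal R :=
  Ideal.span {d | ∃ (v : Fin k → ι → R) (c : Fin k → ι), (∀ i, v i ∈ N) ∧
    d = (Matrix.of fun i j => v i (c j)).det}

/-- Arguments are released from `S` to its span one at a time; the finset `s` records those already
released. -/
theorem MultilinearMap.apply_mem_of_mem_span {α E F : Type*} [Fintype α] [DecidableEq α]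
    [AddCommGroup E] [Module R E] [AddCommGroup F] [Module R F]
    (f : MultilinearMap R (fun _ : α => E) F) (J : Submodule R F) (S : Set E)
    (h : ∀ v : α → E, (∀ i, v i ∈ S) → f v ∈ J) (v : α → E)
    (hv : ∀ i, v i ∈ Submodule.span R S) : f v ∈ J := by
  suffices H : ∀ (s : Finset α) (v : α → E), (∀ i ∈ s, v i ∈ Submodule.span R S) →
      (∀ i ∉ s, v i ∈ S) → f v ∈ J from
    H Finset.univ v (fun i _ => hv i) (fun i hi => absurd (Finset.mem_univ i) hi)
  intro s
  induction s using Finset.induction_on with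
  | empty => exact fun v _ h' => h v fun i => h' i (Finset.notMem_empty i)
  | insert a s ha ih =>
    intro v hs hns
    have key : ∀ x ∈ Submodule.span R S, f (Function.update v a x) ∈ J := by
      intro x hx
      induction hx using Submodule.span_induction with
      | mem x hx =>
        apply ih
        · intro i hi
          rw [Function.update_of_ne (ne_of_mem_of_not_mem hi ha)]
          exact hs i (Finset.mem_insert_of_mem hi)
        · intro i hi
          by_cases hia : i = a
          · subst hia; simpa using hx
          · rw [Function.update_of_ne hia]
            exact hns i (by simp [hia, hi])
      | zero => rw [f.map_update_zero]; exact J.zero_mem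
      | add x y _ _ hx hy => rw [f.map_update_add]; exact J.add_mem hx hy
      | smul r x _ hx => rw [f.map_update_smul]; exact J.smul_mem r hx
    simpa using key (v a) (hs a (Finset.mem_insert_self a s))

theorem minorsIdeal_span_le {k : ℕ} {S : Set (ι → R)} {J : Ideal R}
    (h : ∀ (v : Fin k → ι → R) (c : Fin k → ι), (∀ i, v i ∈ S) →
      (Matrix.of fun i j => v i (c j)).det ∈ J) :
    minorsIdeal k (Submodule.span R S) ≤ J := by
  refine Ideal.span_le.2 ?_
  rintro _ ⟨v, c, hv, rfl⟩
  exact ((Matrix.detRowAlternating (R := R) (n := Fin k)).toMultilinearMap.compLinearMap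
    fun _ => LinearMap.funLeft R R c).apply_mem_of_mem_span J S (fun v hv => h v c hv) v hv

theorem det_mem_minorsIdeal {k : ℕ} {N : Submodule R (ι → R)} (v : Fin k → ι → R)
    (c : Fin k → ι) (hv : ∀ i, v i ∈ N) :
    (Matrix.of fun i j => v i (c j)).det ∈ minorsIdeal k N :=
  Ideal.subset_span ⟨v, c, hv, rfl⟩

/-- Adjoining the relation `y = ∑ wᵢ xᵢ` for a new generator `y` preserves the ideal of minors. -/
theorem minorsIdeal_option (k : ℕ) (N : Submodule R (ι → R)) (w : ι → R) :
    minorsIdeal (k + 1) (Submodule.span R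
      (insert (fun o : Option ι => o.elim 1 (-w)) ((fun v o => o.elim 0 v) '' (N : Set (ι → R))))) =
      minorsIdeal k N := by
  set g : Option ι → R := fun o => o.elim 1 (-w) with hg
  set e : (ι → R) → Option ι → R := fun v o => o.elim 0 v with he
  apply le_antisymm
  · apply minorsIdeal_span_le
    intro v c hv
    -- Two rows equal to `g` make the determinant vanish, so `g` may be assumed to occur at most in
    -- row `p`, along which the determinant is expanded.
    obtain ⟨p, hp⟩ : ∃ p, (∀ q, q ≠ p → v q ∈ e '' (N : Set (ι → R))) ∨
        (Matrix.of fun i j => v i (c j)).det = 0 := by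
      by_cases h : ∃ p, v p = g
      · obtain ⟨p, hp⟩ := h
        refine ⟨p, ?_⟩
        by_cases h' : ∃ q, q ≠ p ∧ v q = g
        · obtain ⟨q, hqp, hq⟩ := h'
          exact Or.inr (Matrix.det_zero_of_row_eq hqp (by ext j; simp [hp, hq]))
        · push Not at h'
          exact Or.inl fun q hq => (hv q).resolve_left (h' q hq)
      · push Not at h
        exact ⟨0, Or.inl fun q _ => (hv q).resolve_left (h q)⟩
    rcases hp with hp | hp
    · rw [Matrix.det_succ_row _ p]
      refine Ideal.sum_mem _ fun j _ => Ideal.mul_mem_left _ _ ?_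
      choose! z hz hz' using hp
      by_cases hc : ∃ i, c (j.succAbove i) = none
      · obtain ⟨i, hi⟩ := hc
        rw [Matrix.det_eq_zero_of_column_eq_zero i]
        · exact Ideal.zero_mem _
        · intro q
          have := hz' _ (Fin.succAbove_ne p q)
          simp [← this, hi, he]
      · have hc' : ∀ i, ∃ l, some l = c (j.succAbove i) := fun i =>
          Option.ne_none_iff_exists.1 fun h => hc ⟨i, h⟩
        choose c' hc' using hc'
        convert det_mem_minorsIdeal (N := N) (fun i => z (p.succAbove i)) c'
          (fun i => hz _ (Fin.succAbove_ne p i)) using 2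
        ext i l
        have := hz' _ (Fin.succAbove_ne p i)
        simp [← this, ← hc', he]
    · rw [hp]; exact Ideal.zero_mem _
  · refine Ideal.span_le.2 ?_
    rintro _ ⟨v, c, hv, rfl⟩
    -- A given minor is bordered by the row `g` and the column `none`; that column is `1, 0, …, 0`,
    -- so the determinant is unchanged.
    have := det_mem_minorsIdeal (N := Submodule.span R (insert g (e '' (N : Set (ι → R)))))
      (Fin.cons g fun i => e (v i)) (Fin.cons none fun i => some (c i)) (by
        intro i
        refine Submodule.subset_span ?_
        refine Fin.cases ?_ (fun i => ?_) i
        · exact Or.inl rfl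
        · exact Or.inr ⟨v i, hv i, rfl⟩)
    rw [Matrix.det_succ_column_zero, Fin.sum_univ_succ, Finset.sum_eq_zero] at this
    · rw [SetLike.mem_coe]
      convert this using 1
      rw [add_zero, Matrix.of_apply]
      simp only [Fin.cons_zero, Fin.val_zero, pow_zero, one_mul]
      rw [show g none = 1 from rfl, one_mul]
      rfl
    · intro i _
      simp [he]

variable [AddCommGroup M] [Module R M] [AddCommGroup M'] [Module R M']
  [Fintype ι] [Fintype κ]

/-- The ideal of `k × k` minors of the relations between the members of a finite family. -/
def relationsMinors (k : ℕ) (x : ι → M) : Ideal R :=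
  minorsIdeal k (LinearMap.ker (Fintype.linearCombination R x))

theorem relationsMinors_comp_equiv_le (k : ℕ) (x : ι → M) (e : κ ≃ ι) :
    relationsMinors (R := R) k (x ∘ e) ≤ relationsMinors k x := by
  refine Ideal.span_le.2 ?_
  rintro _ ⟨v, c, hv, rfl⟩
  have := det_mem_minorsIdeal (N := LinearMap.ker (Fintype.linearCombination R x))
    (fun i => v i ∘ e.symm) (e ∘ c) fun i => by
      rw [LinearMap.mem_ker, ← LinearMap.mem_ker.1 (hv i), Fintype.linearCombination_apply,
        Fintype.linearCombination_apply]
      exact Fintype.sum_equiv e.symm _ _ (by simp)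
  simpa [relationsMinors] using this

theorem relationsMinors_comp_equiv (k : ℕ) (x : ι → M) (e : κ ≃ ι) :
    relationsMinors (R := R) k (x ∘ e) = relationsMinors k x := by
  refine le_antisymm (relationsMinors_comp_equiv_le k x e) ?_
  have := relationsMinors_comp_equiv_le (R := R) k (x ∘ e) e.symm
  rwa [Function.comp_assoc, Equiv.self_comp_symm, Function.comp_id] at this

theorem relationsMinors_comp_injective (k : ℕ) (x : ι → M) (f : M →ₗ[R] M')
    (hf : Function.Injective f) : relationsMinors (R := R) k (f ∘ x) = relationsMinors k x := by
  have : Fintype.linearCombination R (f ∘ x) = f ∘ₗ Fintype.linearCombination R x := by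
    ext; simp [Fintype.linearCombination_apply]
  rw [relationsMinors, this, LinearMap.ker_comp_of_ker_eq_bot _ (LinearMap.ker_eq_bot.2 hf),
    relationsMinors]

/-- The relations of the enlarged family are generated by those of `x` and the one relation
expressing `z none` through `x`, so `minorsIdeal_option` applies. -/
theorem relationsMinors_option (k : ℕ) (x : ι → M) (z : Option ι → M) (hz : ∀ i, z (some i) = x i)
    (h : z none ∈ Submodule.span R (Set.range x)) :
    relationsMinors (R := R) (k + 1) z = relationsMinors k x := by
  obtain ⟨w, hw⟩ := (Submodule.mem_span_range_iff_exists_fun R).1 h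
  rw [relationsMinors, relationsMinors, ← minorsIdeal_option k _ w]
  congr 1
  apply le_antisymm
  · intro v hv
    rw [LinearMap.mem_ker, Fintype.linearCombination_apply, Fintype.sum_option, ← hw] at hv
    have : v = v none • (fun o : Option ι => o.elim 1 (-w)) +
        (fun o : Option ι => o.elim 0 ((fun i => v (some i)) + v none • w)) := by
      ext o
      cases o <;> simp
    rw [this]
    refine Submodule.add_mem _ (Submodule.smul_mem _ _ (Submodule.subset_span (Or.inl rfl)))
      (Submodule.subset_span (Or.inr ⟨_, ?_, rfl⟩))
    rw [SetLike.mem_coe, LinearMap.mem_ker, Fintype.linearCombination_apply, ← hv]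
    simp [hz, add_smul, Finset.sum_add_distrib, Finset.smul_sum, mul_smul, add_comm]
  · rw [Submodule.span_le, Set.insert_subset_iff]
    constructor
    · simp [Fintype.linearCombination_apply, Fintype.sum_option, ← hw, hz]
    · rintro _ ⟨v, hv, rfl⟩
      simpa [Fintype.linearCombination_apply, Fintype.sum_option, hz] using hv

theorem relationsMinors_sumElim (k : ℕ) (x : ι → M) (hx : Submodule.span R (Set.range x) = ⊤)
    (y : κ → M) :
    relationsMinors (R := R) (k + Fintype.card κ) (Sum.elim x y) = relationsMinors k x := by
  revert y
  refine Fintype.induction_empty_option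
    (P := fun κ _ => ∀ y : κ → M,
      relationsMinors (R := R) (k + Fintype.card κ) (Sum.elim x y) = relationsMinors k x)
    ?_ ?_ ?_ κ
  · intro α β _ e ih y
    let _ := Fintype.ofEquiv β e.symm
    rw [← ih (y ∘ e), ← relationsMinors_comp_equiv _ _ (Equiv.sumCongr (Equiv.refl ι) e),
      Fintype.card_congr e]
    congr 1
    ext i
    cases i <;> rfl
  · intro y
    rw [← relationsMinors_comp_equiv _ _ (Equiv.sumEmpty ι PEmpty).symm]
    rfl
  · intro α _ ih y
    let e : Option (ι ⊕ α) ≃ ι ⊕ Option α :=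
      { toFun := fun o => o.elim (Sum.inr none) (Sum.map id some)
        invFun := Sum.elim (fun i => some (Sum.inl i)) fun o => o.elim none (some ∘ Sum.inr)
        left_inv := by rintro (_ | _ | _) <;> rfl
        right_inv := by rintro (_ | _ | _) <;> rfl }
    rw [← ih (y ∘ some), ← relationsMinors_comp_equiv _ _ e, Fintype.card_option, ← add_assoc]
    refine relationsMinors_option _ _ _ (by rintro (_ | _) <;> rfl) ?_
    rw [eq_top_iff.2 (hx.ge.trans (Submodule.span_mono ?_))]
    · trivial
    · rintro _ ⟨i, rfl⟩
      exact ⟨Sum.inl i, rfl⟩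

/-- The Fitting ideals of a module do not depend on the finite generating family. -/
theorem relationsMinors_eq_of_span_eq_top {k l : ℕ} (x : ι → M) (y : κ → M)
    (hx : Submodule.span R (Set.range x) = ⊤) (hy : Submodule.span R (Set.range y) = ⊤)
    (h : k + Fintype.card κ = l + Fintype.card ι) :
    relationsMinors (R := R) k x = relationsMinors l y := by
  -- Both families are compared with their disjoint union; `h` says that the two minor sizes grow to
  -- the same size there.
  rw [← relationsMinors_sumElim k x hx y, ← relationsMinors_sumElim l y hy x, h,
    ← relationsMinors_comp_equiv _ _ (Equiv.sumComm κ ι)]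
  congr 1
  ext i
  cases i <;> rfl

end Minors
end

noncomputable section

/-! ### The Alexander module of a presentation -/

/-- A crossed homomorphism on a free group is determined by its values on the generators. -/
theorem FreeGroup.crossedHom_ext {ι R X : Type*} [CommRing R] [AddCommGroup X] [Module R X]
    (a : FreeGroup ι →* R) {δ δ' : FreeGroup ι → X}
    (h : ∀ u v, δ (u * v) = δ u + a u • δ v) (h' : ∀ u v, δ' (u * v) = δ' u + a u • δ' v)
    (hgen : ∀ i, δ (FreeGroup.of i) = δ' (FreeGroup.of i)) : δ = δ' := by
  have h1 : δ 1 = 0 := by simpa using h 1 1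
  have h1' : δ' 1 = 0 := by simpa using h' 1 1
  funext w
  induction w using FreeGroup.induction_on with
  | C1 => rw [h1, h1']
  | of i => exact hgen i
  | inv_of i _ =>
    have e := h (FreeGroup.of i)⁻¹ (FreeGroup.of i)
    have e' := h' (FreeGroup.of i)⁻¹ (FreeGroup.of i)
    rw [inv_mul_cancel, h1] at e
    rw [inv_mul_cancel, h1', ← hgen] at e'
    rw [eq_neg_of_add_eq_zero_left e.symm, eq_neg_of_add_eq_zero_left e'.symm]
  | mul u v hu hv => rw [h, h', hu, hv]

namespace FinitePresentation

variable {G : Type*} [Group G] (P : FinitePresentation G)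
  (α : Abelianization G ≃* Multiplicative ℤ)

/-- The vector `(α_*(∂w/∂xⱼ))ⱼ` of Fox derivatives of `w`. -/
def foxVector (w : FreeGroup (Fin P.n)) : Fin P.n → ℤ[T;T⁻¹] := fun j =>
  alphaStar α (P.proj (foxDeriv j (MonoidAlgebra.of ℤ (FreeGroup (Fin P.n)) w)))

/-- The monoid homomorphism `G → ℤ[t, t⁻¹]` underlying `α_*`. -/
def alphaHom {G : Type*} [Group G] (α : Abelianization G ≃* Multiplicative ℤ) : G →* ℤ[T;T⁻¹] :=
  (alphaStar α).toMonoidHom.comp (MonoidAlgebra.of ℤ G)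

theorem alphaHom_apply (g : G) :
    alphaHom α g = LaurentPolynomial.T (α (Abelianization.of g)).toAdd := by
  change MonoidAlgebra.lift ℤ ℤ[T;T⁻¹] G _ (MonoidAlgebra.of ℤ G g) = _
  rw [MonoidAlgebra.lift_of]
  rfl

theorem alphaStar_proj_of (w : FreeGroup (Fin P.n)) :
    alphaStar α (P.proj (MonoidAlgebra.of ℤ (FreeGroup (Fin P.n)) w)) =
      alphaHom α (FreeGroup.lift P.gen w) := by
  simp [alphaHom, proj]

theorem foxVector_mul (u v : FreeGroup (Fin P.n)) :
    P.foxVector α (u * v) =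
      P.foxVector α u + alphaHom α (FreeGroup.lift P.gen u) • P.foxVector α v := by
  ext1 j
  rw [Pi.add_apply, Pi.smul_apply, smul_eq_mul, foxVector, foxDeriv_mul, map_add, map_add, map_mul,
    map_mul, alphaStar_proj_of]
  rfl

theorem foxVector_of (j : Fin P.n) : P.foxVector α (FreeGroup.of j) = Pi.single j 1 := by
  ext1 i
  rw [foxVector, foxDeriv_generator, Pi.single_apply]
  by_cases h : j = i
  · simp [h]
  · simp [h, Ne.symm h]

theorem foxVector_one : P.foxVector α 1 = 0 := by
  simpa using P.foxVector_mul α 1 1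

/-- The row space of the Alexander matrix. -/
def alexanderRelations : Submodule ℤ[T;T⁻¹] (Fin P.n → ℤ[T;T⁻¹]) :=
  Submodule.span _ (Set.range (P.alexanderMatrix α).row)

/-- On the kernel the Fox vector is additive, and conjugation by `g` multiplies it by `α(g)`. Hence
the kernel elements with vector in the row space form a normal subgroup containing the relators. -/
theorem foxVector_mem_of_lift_eq_one (w : FreeGroup (Fin P.n)) (hw : FreeGroup.lift P.gen w = 1) :
    P.foxVector α w ∈ P.alexanderRelations α := by
  let K : Subgroup (FreeGroup (Fin P.n)) :=
    { carrier := {w | FreeGroup.lift P.gen w = 1 ∧ P.foxVector α w ∈ P.alexanderRelations α}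
      one_mem' := ⟨map_one _, by rw [foxVector_one]; exact Submodule.zero_mem _⟩
      mul_mem' := by
        rintro u v ⟨hu, hu'⟩ ⟨hv, hv'⟩
        refine ⟨by rw [map_mul, hu, hv, one_mul], ?_⟩
        rw [foxVector_mul]
        exact Submodule.add_mem _ hu' (Submodule.smul_mem _ _ hv')
      inv_mem' := by
        rintro u ⟨hu, hu'⟩
        refine ⟨by rw [map_inv, hu, inv_one], ?_⟩
        have := P.foxVector_mul α u⁻¹ u
        rw [inv_mul_cancel, foxVector_one] at this
        rw [eq_neg_of_add_eq_zero_left this.symm]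
        exact Submodule.neg_mem _ (Submodule.smul_mem _ _ hu') }
  have hK : K.Normal := ⟨by
    rintro u ⟨hu, hu'⟩ g
    have h1 : FreeGroup.lift P.gen (g * u * g⁻¹) = 1 := by simp [hu]
    refine ⟨h1, ?_⟩
    -- The product rule is applied to both sides of `(g u g⁻¹) g = g u`.
    have h2 := P.foxVector_mul α (g * u * g⁻¹) g
    rw [inv_mul_cancel_right, h1, map_one, one_smul,
      P.foxVector_mul α g u, add_comm] at h2
    have h3 := add_right_cancel h2
    change P.foxVector α (g * u * g⁻¹) ∈ P.alexanderRelations α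
    rw [← h3]
    exact Submodule.smul_mem _ _ hu'⟩
  have hle : Subgroup.normalClosure (Set.range P.rel) ≤ K := by
    refine Subgroup.normalClosure_le_normal ?_
    rintro _ ⟨i, rfl⟩
    refine ⟨?_, Submodule.subset_span ⟨i, rfl⟩⟩
    rw [← MonoidHom.mem_ker, P.ker_lift]
    exact Subgroup.subset_normalClosure ⟨i, rfl⟩
  rw [← P.ker_lift] at hle
  exact (hle hw).2

/-- The Alexander module, presented by the Alexander matrix. -/
abbrev AlexanderModule : Type := (Fin P.n → ℤ[T;T⁻¹]) ⧸ P.alexanderRelations α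

/-- The universal crossed homomorphism from the group to the Alexander module. -/
def alexanderCrossedHom (g : G) : P.AlexanderModule α :=
  Submodule.Quotient.mk (P.foxVector α (P.lift_surjective g).choose)

/-- The chosen word does not matter: `w` and `w'` differ by the kernel element `w'⁻¹ w`. -/
theorem alexanderCrossedHom_lift (w : FreeGroup (Fin P.n)) :
    P.alexanderCrossedHom α (FreeGroup.lift P.gen w) = Submodule.Quotient.mk (P.foxVector α w) := by
  rw [alexanderCrossedHom, eq_comm, Submodule.Quotient.eq]
  set w' := (P.lift_surjective (FreeGroup.lift P.gen w)).choose
  have hw' : FreeGroup.lift P.gen w' = FreeGroup.lift P.gen w :=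
    (P.lift_surjective (FreeGroup.lift P.gen w)).choose_spec
  have h := P.foxVector_mul α w' (w'⁻¹ * w)
  rw [mul_inv_cancel_left] at h
  rw [h, add_sub_cancel_left]
  exact Submodule.smul_mem _ _ (P.foxVector_mem_of_lift_eq_one α _ (by simp [hw']))

theorem alexanderCrossedHom_mul (g h : G) :
    P.alexanderCrossedHom α (g * h) =
      P.alexanderCrossedHom α g + alphaHom α g • P.alexanderCrossedHom α h := by
  obtain ⟨u, rfl⟩ := P.lift_surjective g
  obtain ⟨v, rfl⟩ := P.lift_surjective h
  rw [← map_mul, alexanderCrossedHom_lift, foxVector_mul, alexanderCrossedHom_lift,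
    alexanderCrossedHom_lift, Submodule.Quotient.mk_add, Submodule.Quotient.mk_smul]

theorem alexanderCrossedHom_gen (j : Fin P.n) :
    P.alexanderCrossedHom α (P.gen j) = Submodule.Quotient.mk (Pi.single j 1) := by
  rw [← foxVector_of, ← alexanderCrossedHom_lift, FreeGroup.lift_apply_of]

/-- Both sides are crossed homomorphisms on the free group with the same values on generators. This
yields both the universal property and the fundamental formula. -/
theorem linearCombination_foxVector {X : Type*} [AddCommGroup X] [Module ℤ[T;T⁻¹] X] (d : G → X)
    (hd : ∀ g h, d (g * h) = d g + alphaHom α g • d h) (w : FreeGroup (Fin P.n)) :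
    Fintype.linearCombination ℤ[T;T⁻¹] (fun j => d (P.gen j)) (P.foxVector α w) =
      d (FreeGroup.lift P.gen w) := by
  refine congrFun (FreeGroup.crossedHom_ext ((alphaHom α).comp (FreeGroup.lift P.gen))
    (δ := fun w => Fintype.linearCombination ℤ[T;T⁻¹] (fun j => d (P.gen j)) (P.foxVector α w))
    (δ' := fun w => d (FreeGroup.lift P.gen w)) ?_ ?_ ?_) w
  · intro u v
    simp only [foxVector_mul, map_add, map_smul, MonoidHom.comp_apply]
  · intro u v
    simp only [map_mul, hd, MonoidHom.comp_apply]
  · intro i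
    simp [foxVector_of, Fintype.linearCombination_apply_single]

/-- The linear map from the Alexander module induced by a crossed homomorphism. -/
def alexanderLift {X : Type*} [AddCommGroup X] [Module ℤ[T;T⁻¹] X] (d : G → X)
    (hd : ∀ g h, d (g * h) = d g + alphaHom α g • d h) : P.AlexanderModule α →ₗ[ℤ[T;T⁻¹]] X :=
  Submodule.liftQ _ (Fintype.linearCombination ℤ[T;T⁻¹] fun j => d (P.gen j)) (by
    rw [alexanderRelations, Submodule.span_le]
    rintro _ ⟨i, rfl⟩
    have hi : FreeGroup.lift P.gen (P.rel i) = 1 := by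
      rw [← MonoidHom.mem_ker, P.ker_lift]
      exact Subgroup.subset_normalClosure ⟨i, rfl⟩
    have h1 : d 1 = 0 := by simpa using hd 1 1
    exact (P.linearCombination_foxVector α d hd (P.rel i)).trans (by rw [hi, h1]))

theorem alexanderLift_crossedHom {X : Type*} [AddCommGroup X] [Module ℤ[T;T⁻¹] X] (d : G → X)
    (hd : ∀ g h, d (g * h) = d g + alphaHom α g • d h) (g : G) :
    P.alexanderLift α d hd (P.alexanderCrossedHom α g) = d g := by
  obtain ⟨w, rfl⟩ := P.lift_surjective g
  rw [alexanderCrossedHom_lift, ← linearCombination_foxVector P α d hd]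
  rfl

theorem linearCombination_alexanderCrossedHom_gen :
    Fintype.linearCombination ℤ[T;T⁻¹] (fun j => P.alexanderCrossedHom α (P.gen j)) =
      (P.alexanderRelations α).mkQ := by
  ext j
  simp [Fintype.linearCombination_apply_single, alexanderCrossedHom_gen]

theorem span_alexanderCrossedHom_gen :
    Submodule.span ℤ[T;T⁻¹] (Set.range fun j => P.alexanderCrossedHom α (P.gen j)) = ⊤ := by
  rw [← Fintype.range_linearCombination, linearCombination_alexanderCrossedHom_gen,
    Submodule.range_mkQ]

/-- The composite fixes the values of the crossed homomorphism on the generators, and these span. -/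
theorem alexanderLift_comp (P' : FinitePresentation G) :
    (P'.alexanderLift α _ (P.alexanderCrossedHom_mul α)) ∘ₗ
      (P.alexanderLift α _ (P'.alexanderCrossedHom_mul α)) = LinearMap.id := by
  refine LinearMap.ext_on_range (P.span_alexanderCrossedHom_gen α) fun j => ?_
  rw [LinearMap.comp_apply, alexanderLift_crossedHom, alexanderLift_crossedHom, LinearMap.id_apply]

/-- The ideal generated by the `(n - 1) × (n - 1)` minors of the Alexander matrix is an invariant
of the group. -/
theorem minorsIdeal_alexanderRelations_eq (P' : FinitePresentation G) (hn : 0 < P.n)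
    (hn' : 0 < P'.n) :
    minorsIdeal (P.n - 1) (P.alexanderRelations α) =
      minorsIdeal (P'.n - 1) (P'.alexanderRelations α) := by
  have key : ∀ P : FinitePresentation G, relationsMinors (P.n - 1)
      (fun j => P.alexanderCrossedHom α (P.gen j)) =
        minorsIdeal (P.n - 1) (P.alexanderRelations α) := fun P => by
    rw [relationsMinors, linearCombination_alexanderCrossedHom_gen, Submodule.ker_mkQ]
  let f := P.alexanderLift α _ (P'.alexanderCrossedHom_mul α)
  have hinj : Function.Injective f :=
    Function.LeftInverse.injective (LinearMap.congr_fun (P.alexanderLift_comp α P'))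
  have hsurj : Function.Surjective f :=
    Function.RightInverse.surjective (LinearMap.congr_fun (P'.alexanderLift_comp α P))
  rw [← key, ← key, ← relationsMinors_comp_injective _ _ f hinj]
  refine relationsMinors_eq_of_span_eq_top _ _ ?_ (P'.span_alexanderCrossedHom_gen α) ?_
  · rw [Set.range_comp, ← Submodule.map_span, span_alexanderCrossedHom_gen, Submodule.map_top,
      LinearMap.range_eq_top.2 hsurj]
  · simp only [Fintype.card_fin]
    -- Positivity of `P.n` and `P'.n` matters here because `n - 1` is truncated subtraction.
    omega

/-- The fundamental formula `∑ⱼ (∂r/∂xⱼ)(xⱼ - 1) = r - 1`, applied to the relators. -/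
theorem sum_alexanderMatrix_mul_denominator (i : Fin P.m) :
    ∑ j, P.alexanderMatrix α i j * P.denominator α j = 0 := by
  -- The map `g ↦ α(g) - 1` is itself a crossed homomorphism.
  have h := P.linearCombination_foxVector α (fun g => alphaHom α g - 1)
    (fun g h => by simp only [map_mul, smul_eq_mul]; ring) (P.rel i)
  have hi : FreeGroup.lift P.gen (P.rel i) = 1 := by
    rw [← MonoidHom.mem_ker, P.ker_lift]
    exact Subgroup.subset_normalClosure ⟨i, rfl⟩
  rw [hi, map_one, sub_self] at h
  exact h

end FinitePresentation
end

noncomputable section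

/-! ### The ring of Laurent polynomials over `ℤ` -/

section Laurent

open LaurentPolynomial

/-- `ℤ[t, t⁻¹]` is the localization of the factorial ring `ℤ[X]` at the powers of `X`. -/
instance : UniqueFactorizationMonoid ℤ[T;T⁻¹] :=
  UniqueFactorizationMonoid.of_isLocalization (Submonoid.powers (Polynomial.X : Polynomial ℤ)) _

/-- The units of `ℤ[t, t⁻¹]` are `± tˢ`. -/
theorem LaurentPolynomial.exists_eq_C_mul_T_of_isUnit (f : ℤ[T;T⁻¹]) (hf : IsUnit f) :
    ∃ (ε : ℤˣ) (s : ℤ), f = C (ε : ℤ) * T s := by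
  obtain ⟨g, hg⟩ := hf.exists_right_inv
  obtain ⟨n, p, hp⟩ := exists_T_pow f
  obtain ⟨m, q, hq⟩ := exists_T_pow g
  -- After clearing denominators, `p` divides a power of the prime `X`, so it is a unit constant
  -- times a power of `X`.
  have hpq : p * q = Polynomial.X ^ (n + m) := by
    apply Polynomial.toLaurent_injective
    rw [map_mul, hp, hq, Polynomial.toLaurent_X_pow, mul_mul_mul_comm, hg, one_mul, ← T_add]
    push_cast
    rfl
  obtain ⟨i, -, u, hu⟩ := (dvd_prime_pow Polynomial.prime_X _).1 (Dvd.intro q hpq)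
  obtain ⟨r, hr, hr'⟩ := Polynomial.isUnit_iff.1 (u⁻¹).isUnit
  have hp' : p = Polynomial.C r * Polynomial.X ^ i := by
    rw [hr', ← hu, mul_comm, Units.mul_inv_cancel_right]
  refine ⟨hr.unit, i - n, ?_⟩
  have : f = f * T n * T (-n) := by rw [mul_T_assoc, add_neg_cancel, T_zero, mul_one]
  rw [this, ← hp, hp', Polynomial.toLaurent_C_mul_X_pow, mul_assoc, ← T_add, sub_eq_add_neg]
  rfl

end Laurent

/-! ### Greatest common divisors of sets -/

section GCD

variable {R : Type*} [CommRing R]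

/-- `Q` is a greatest common divisor of the set `S`. -/
def IsSetGCD (S : Set R) (Q : R) : Prop :=
  (∀ D ∈ S, Q ∣ D) ∧ ∀ E : R, (∀ D ∈ S, E ∣ D) → E ∣ Q

theorem exists_isSetGCD [IsGCDMonoid R] {S : Set R} (hS : S.Finite) : ∃ Q, IsSetGCD S Q := by
  obtain ⟨_⟩ := ‹IsGCDMonoid R›
  induction S, hS using Set.Finite.induction_on with
  | empty => exact ⟨0, by simp [IsSetGCD]⟩
  | insert _ _ ih =>
    rename_i a s _ _
    obtain ⟨Q, hQ, hQ'⟩ := ih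
    refine ⟨gcd a Q, ?_, ?_⟩
    · rintro D (rfl | hD)
      · exact gcd_dvd_left _ _
      · exact (gcd_dvd_right _ _).trans (hQ D hD)
    · intro E hE
      exact dvd_gcd (hE a (Or.inl rfl)) (hQ' E fun D hD => hE D (Or.inr hD))

/-- Greatest common divisors commute with scaling: after cancelling `gcd X a`, the cofactor `X'` is
coprime to `a'`, hence divides every `s`. -/
theorem IsSetGCD.dvd_mul [IsDomain R] [IsGCDMonoid R] {S : Set R} {Q : R} (h : IsSetGCD S Q)
    {a X : R} (hX : ∀ s ∈ S, X ∣ s * a) : X ∣ Q * a := by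
  obtain ⟨_⟩ := ‹IsGCDMonoid R›
  by_cases ha : a = 0
  · simp [ha]
  obtain ⟨X', a', hX', ha', hu⟩ := extract_gcd X a
  have hg : gcd X a ≠ 0 := fun h0 => ha ((gcd_eq_zero_iff _ _).1 h0).2
  generalize gcd X a = g at *
  subst hX' ha'
  simp only [mul_left_comm _ g, mul_dvd_mul_iff_left hg] at hX ⊢
  exact (h.2 X' fun s hs =>
    (gcd_isUnit_iff_isRelPrime.1 hu).dvd_of_dvd_mul_right (hX s hs)).mul_right _

theorem isSetGCD_span_iff {S : Set R} {Q : R} :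
    IsSetGCD (Ideal.span S : Set R) Q ↔ IsSetGCD S Q := by
  have key : ∀ E : R, (∀ D ∈ (Ideal.span S : Set R), E ∣ D) ↔ ∀ D ∈ S, E ∣ D := by
    intro E
    have := Ideal.span_le (s := S) (I := Ideal.span {E})
    simpa only [SetLike.le_def, Set.subset_def, SetLike.mem_coe, Ideal.mem_span_singleton] using this
  simp only [IsSetGCD, key]

end GCD

/-! ### Minors of a matrix with a kernel vector -/

section Core

variable {R ι μ : Type*} [CommRing R] {N : ℕ}

/-- The minor of `A` on the rows `r` and columns `c`. -/
def minor (A : Matrix μ ι R) (r : Fin N → μ) (c : Fin N → ι) : R :=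
  (Matrix.of fun i j => A (r i) (c j)).det

theorem minor_eq_zero_of_not_injective_cols (A : Matrix μ ι R) (r : Fin N → μ) (c : Fin N → ι)
    (hc : ¬ Function.Injective c) : minor A r c = 0 := by
  simp only [Function.Injective] at hc
  push Not at hc
  obtain ⟨i, j, hij, hne⟩ := hc
  exact Matrix.det_zero_of_column_eq hne fun k => by simp [hij]

theorem minor_eq_zero_of_not_injective_rows (A : Matrix μ ι R) (r : Fin N → μ) (c : Fin N → ι)
    (hr : ¬ Function.Injective r) : minor A r c = 0 := by
  simp only [Function.Injective] at hr
  push Not at hr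
  obtain ⟨i, j, hij, hne⟩ := hr
  exact Matrix.det_zero_of_row_eq hne (by ext k; simp [hij])

/-- The minors of `A` avoiding the column `k`. -/
def minorsAvoiding (N : ℕ) (A : Matrix μ ι R) (k : ι) : Set R :=
  {d | ∃ (r : Fin N → μ) (c : Fin N → ι), (∀ p, c p ≠ k) ∧ d = minor A r c}

theorem minor_mem_minorsIdeal (A : Matrix μ ι R) (r : Fin N → μ) (c : Fin N → ι) :
    minor A r c ∈ minorsIdeal N (Submodule.span R (Set.range A.row)) :=
  det_mem_minorsIdeal (fun i => A.row (r i)) c fun i => Submodule.subset_span ⟨r i, rfl⟩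

theorem minorsIdeal_span_range (A : Matrix μ ι R) :
    minorsIdeal N (Submodule.span R (Set.range A.row)) =
      Ideal.span (Set.range fun x : (Fin N → μ) × (Fin N → ι) => minor A x.1 x.2) := by
  apply le_antisymm
  · apply minorsIdeal_span_le
    intro v c hv
    choose r hr using hv
    obtain rfl : v = fun i => A.row (r i) := funext fun i => (hr i).symm
    exact Ideal.subset_span ⟨(r, c), rfl⟩
  · rw [Ideal.span_le]
    rintro _ ⟨x, rfl⟩
    exact minor_mem_minorsIdeal A _ _

variable [Fintype ι]

theorem exists_eq_of_injective_of_ne (hι : Fintype.card ι = N + 1) (c : Fin N → ι)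
    (hc : Function.Injective c) {i j : ι} (hj : ∀ p, c p ≠ j) (hi : i ≠ j) : ∃ q, c q = i := by
  classical
  have himg : Finset.univ.image c = Finset.univ.erase j := by
    refine Finset.eq_of_subset_of_card_le ?_ ?_
    · intro i hi
      obtain ⟨q, -, rfl⟩ := Finset.mem_image.1 hi
      exact Finset.mem_erase.2 ⟨hj q, Finset.mem_univ _⟩
    · rw [Finset.card_erase_of_mem (Finset.mem_univ _), Finset.card_univ, hι,
        Finset.card_image_of_injective _ hc, Finset.card_univ, Fintype.card_fin]
      rfl
  have : i ∈ Finset.univ.image c := himg ▸ Finset.mem_erase.2 ⟨hi, Finset.mem_univ _⟩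
  obtain ⟨q, -, hq⟩ := Finset.mem_image.1 this
  exact ⟨q, hq⟩

/-- Cramer's rule: the vanishing combination `∑ uᵢ Aᵢ` of columns is put in place `p` of the minor.
Every column other than `c p` and `j` already occurs elsewhere in the minor, so only two terms
survive. -/
theorem mul_minor_eq_neg [DecidableEq ι] (hι : Fintype.card ι = N + 1) (A : Matrix μ ι R) (u : ι → R)
    (hA : ∀ i, ∑ j, A i j * u j = 0) (r : Fin N → μ) (c : Fin N → ι)
    (hc : Function.Injective c) {j : ι} (hj : ∀ p, c p ≠ j) (p : Fin N) :
    u (c p) * minor A r c = -(u j * minor A r (Function.update c p j)) := by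
  let M : Matrix (Fin N) (Fin N) R := Matrix.of fun i j => A (r i) (c j)
  have hupd : ∀ i, minor A r (Function.update c p i) = (M.updateCol p fun q => A (r q) i).det := by
    intro i
    rw [minor]
    congr 1
    ext a b
    by_cases hb : b = p
    · subst hb; simp
    · simp [hb, M]
  have hsum : ∑ i, u i * minor A r (Function.update c p i) = 0 := by
    let f := (Matrix.detRowAlternating (R := R) (n := Fin N)).toMultilinearMap.toLinearMap M.transpose p
    have hf : ∀ x, f x = (M.updateCol p x).det := by
      intro x
      rw [← Matrix.det_transpose, ← Matrix.updateRow_transpose]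
      rfl
    simp_rw [hupd, ← hf, ← smul_eq_mul, ← map_smul, ← map_sum]
    convert map_zero f
    ext q
    simpa [mul_comm] using hA (r q)
  rw [← Finset.sum_subset (Finset.subset_univ {c p, j}), Finset.sum_pair (hj p),
    Function.update_eq_self] at hsum
  · exact eq_neg_of_add_eq_zero_left hsum
  · intro i _ hi
    rw [Finset.mem_insert, Finset.mem_singleton, not_or] at hi
    obtain ⟨q, rfl⟩ := exists_eq_of_injective_of_ne hι c hc hj hi.2
    rw [minor_eq_zero_of_not_injective_cols, mul_zero]
    intro hinj
    have hqp : q ≠ p := fun h => hi.1 (h ▸ rfl)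
    exact hqp (hinj (by simp [hqp]))

/-- If `A u = 0` and `p` generates the ideal of the entries of `u`, then the greatest common divisor
`Q` of the minors avoiding the column `k` and that `Δ` of all minors satisfy `Q p ∼ Δ u_k`. -/
theorem associated_mul_gcd [IsDomain R] [IsGCDMonoid R] (hι : Fintype.card ι = N + 1)
    (A : Matrix μ ι R) (u : ι → R) (hA : ∀ i, ∑ j, A i j * u j = 0) {p : R}
    (hp : Ideal.span (Set.range u) = Ideal.span {p}) (k : ι) {Q Δ : R}
    (hQ : IsSetGCD (minorsAvoiding N A k) Q)
    (hΔ : IsSetGCD (minorsIdeal N (Submodule.span R (Set.range A.row)) : Set R) Δ) :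
    Associated (Q * p) (Δ * u k) := by
  classical
  have hpu : ∀ j, p ∣ u j := fun j =>
    Ideal.mem_span_singleton.1 (hp ▸ Ideal.subset_span ⟨j, rfl⟩)
  apply associated_of_dvd_dvd
  -- For `Q p ∣ Δ u_k`: a minor using column `k` has it exchanged for the missing column `j`, giving
  -- `± u_j` times a minor avoiding `k`; a minor avoiding `k` is divisible by `Q` already.
  · apply hΔ.dvd_mul
    suffices h : minorsIdeal N (Submodule.span R (Set.range A.row)) ≤
        Submodule.comap (LinearMap.mulRight R (u k)) (Ideal.span {Q * p}) from
      fun s hs => Ideal.mem_span_singleton.1 (h hs)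
    rw [minorsIdeal_span_range, Ideal.span_le]
    rintro _ ⟨⟨r, c⟩, rfl⟩
    change minor A r c * u k ∈ Ideal.span {Q * p}
    rw [Ideal.mem_span_singleton]
    by_cases hc : Function.Injective c
    swap
    · simp [minor_eq_zero_of_not_injective_cols A r c hc]
    obtain ⟨j, hj⟩ : ∃ j, ∀ q, c q ≠ j := by
      by_contra! h
      have := Fintype.card_le_of_surjective c h
      rw [hι, Fintype.card_fin] at this
      omega
    by_cases hk : ∃ q, c q = k
    · obtain ⟨q, rfl⟩ := hk
      rw [mul_comm (minor A r c), mul_minor_eq_neg hι A u hA r c hc hj q, dvd_neg, mul_comm (u j)]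
      refine mul_dvd_mul (hQ.1 _ ⟨r, _, fun l => ?_, rfl⟩) (hpu j)
      by_cases hl : l = q
      · subst hl; simpa using (hj l).symm
      · simpa [hl] using fun h => hl (hc h)
    · push Not at hk
      exact mul_dvd_mul (hQ.1 _ ⟨r, c, hk, rfl⟩) (hpu k)
  -- For `Δ u_k ∣ Q p`: as `p` is a combination of the `u_j`, it suffices to treat each `Q u_j`,
  -- where column `j` is exchanged for `k`.
  · suffices h : Ideal.span (Set.range u) ≤
        Submodule.comap (LinearMap.mulLeft R Q) (Ideal.span {Δ * u k}) from
      Ideal.mem_span_singleton.1 (h (hp ▸ Ideal.mem_span_singleton_self p))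
    rw [Ideal.span_le]
    rintro _ ⟨j, rfl⟩
    refine Ideal.mem_span_singleton.2 (hQ.dvd_mul ?_)
    rintro _ ⟨r, c, hck, rfl⟩
    by_cases hc : Function.Injective c
    swap
    · simp [minor_eq_zero_of_not_injective_cols A r c hc]
    by_cases hj : ∃ q, c q = j
    · obtain ⟨q, rfl⟩ := hj
      rw [mul_comm (minor A r c), mul_minor_eq_neg hι A u hA r c hc hck q, dvd_neg, mul_comm (u k)]
      exact mul_dvd_mul_right (hΔ.1 _ (minor_mem_minorsIdeal A r _)) _
    · have hjk : j = k := by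
        by_contra hjk
        exact hj (exists_eq_of_injective_of_ne hι c hc hck hjk)
      rw [hjk]
      exact mul_dvd_mul_right (hΔ.1 _ (minor_mem_minorsIdeal A r _)) _

end Core

/-- Sorting the index function links minors on arbitrary rows and columns to those of
`maximalMinors`, at the cost of a sign. -/
theorem exists_orderEmbedding_comp_perm {X : Type*} [LinearOrder X] {N : ℕ} (f : Fin N → X)
    (hf : Function.Injective f) : ∃ (g : Fin N ↪o X) (σ : Equiv.Perm (Fin N)), f = g ∘ σ := by
  refine ⟨OrderEmbedding.ofStrictMono (f ∘ Tuple.sort f)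
    ((Tuple.monotone_sort f).strictMono_of_injective (hf.comp (Tuple.sort f).injective)),
    (Tuple.sort f).symm, ?_⟩
  ext i
  simp

theorem LaurentPolynomial.T_injective :
    Function.Injective (LaurentPolynomial.T : ℤ → ℤ[T;T⁻¹]) := by
  intro m n h
  have := congrArg (fun f : ℤ[T;T⁻¹] => f.coeff m) h
  by_contra hne
  simp [Ne.symm hne] at this

/-! ### Deficiency, greatest common divisors of maximal minors, and comparison of presentations. -/

namespace FinitePresentation

variable {G : Type*} [Group G] (P : FinitePresentation G)
  (α : Abelianization G ≃* Multiplicative ℤ)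

theorem exists_gen_ne_one : ∃ k, α (Abelianization.of (P.gen k)) ≠ 1 := by
  by_contra! h
  have hF : (α.toMonoidHom.comp Abelianization.of).comp (FreeGroup.lift P.gen) = 1 := by
    ext j
    simpa using h j
  obtain ⟨g, hg⟩ := QuotientGroup.mk_surjective (α.symm (Multiplicative.ofAdd 1))
  obtain ⟨w, rfl⟩ := P.lift_surjective g
  have h1 : α (Abelianization.of (FreeGroup.lift P.gen w)) = 1 := DFunLike.congr_fun hF w
  have h2 : α (Abelianization.of (FreeGroup.lift P.gen w)) = Multiplicative.ofAdd 1 := by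
    rw [← α.apply_symm_apply (Multiplicative.ofAdd 1), ← hg]
    rfl
  exact absurd (h1.symm.trans h2) (by decide)

theorem denominator_eq (k : Fin P.n) : P.denominator α k = alphaHom α (P.gen k) - 1 := rfl


/-- A group with infinite cyclic abelianization has no presentation of deficiency `≥ 2`. -/
theorem n_le_m_add_one (α : Abelianization G ≃* Multiplicative ℤ) : P.n ≤ P.m + 1 := by
  by_contra! hlt
  let F := FreeGroup (Fin P.n)
  let ab : F →* Multiplicative (Fin P.n → ℚ) :=
    FreeGroup.lift fun j => Multiplicative.ofAdd (Pi.single j 1)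
  obtain ⟨k, hk⟩ := P.exists_gen_ne_one α
  -- The exponent sums of the `m` relators and the condition `v k = 0` are `m + 1 < n` linear
  -- equations, so some `v ≠ 0` solves them; it defines a homomorphism `G → ℚ` killing `x_k`.
  let Φ : (Fin P.n → ℚ) →ₗ[ℚ] (Option (Fin P.m) → ℚ) :=
    LinearMap.pi fun o => o.elim (LinearMap.proj k) fun i =>
      Fintype.linearCombination ℚ (ab (P.rel i)).toAdd
  obtain ⟨v, hv, hv0⟩ := (Submodule.ne_bot_iff _).1
    (LinearMap.ker_ne_bot_of_finrank_lt (f := Φ) (by simpa using hlt))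
  have hvk : v k = 0 := congrFun hv none
  have hvr : ∀ i, Fintype.linearCombination ℚ (ab (P.rel i)).toAdd v = 0 :=
    fun i => congrFun hv (some i)
  let h : F →* Multiplicative ℚ := FreeGroup.lift fun j => Multiplicative.ofAdd (v j)
  have hh : h = (AddMonoidHom.toMultiplicative
      (Fintype.linearCombination ℚ v).toAddMonoidHom).comp ab := by
    ext j
    simp [h, ab, Fintype.linearCombination_apply_single]
  have hker : (FreeGroup.lift P.gen).ker ≤ h.ker := by
    rw [P.ker_lift]
    refine Subgroup.normalClosure_le_normal ?_
    rintro _ ⟨i, rfl⟩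
    have := hvr i
    rw [SetLike.mem_coe, MonoidHom.mem_ker, hh]
    refine Multiplicative.toAdd.injective ?_
    simp only [Fintype.linearCombination_apply, smul_eq_mul] at this
    simpa [Fintype.linearCombination_apply, mul_comm] using this
  let h' : G →* Multiplicative ℚ :=
    (FreeGroup.lift P.gen).liftOfSurjective P.lift_surjective ⟨h, hker⟩
  have hh' : ∀ j, (h' (P.gen j)).toAdd = v j := by
    intro j
    have := (FreeGroup.lift P.gen).liftOfRightInverse_comp_apply _
      (Function.rightInverse_surjInv P.lift_surjective) ⟨h, hker⟩ (FreeGroup.of j)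
    rw [FreeGroup.lift_apply_of] at this
    exact congrArg Multiplicative.toAdd (this.trans (FreeGroup.lift_apply_of ..))
  let h'' : Multiplicative ℤ →* Multiplicative ℚ :=
    (Abelianization.lift h').comp α.symm.toMonoidHom
  -- Every homomorphism `G → ℚ` is a multiple of `α`; as `α(x_k) ≠ 0`, vanishing at `x_k` makes it
  -- zero, against `v ≠ 0`.
  have hh'' : ∀ g, (h' g).toAdd =
      (α (Abelianization.of g)).toAdd * (h'' (Multiplicative.ofAdd 1)).toAdd := by
    intro g
    have h1 : h' g = h'' (α (Abelianization.of g)) := by simp [h'']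
    have h2 : α (Abelianization.of g) =
      (Multiplicative.ofAdd (1 : ℤ)) ^ (α (Abelianization.of g)).toAdd := by
      rw [← ofAdd_zsmul]; simp
    rw [h1, h2, map_zpow]
    simp
  apply hv0
  have hc : (h'' (Multiplicative.ofAdd 1)).toAdd = 0 := by
    have := hh'' (P.gen k)
    rw [hh', hvk] at this
    refine (mul_eq_zero.1 this.symm).resolve_left ?_
    simpa using hk
  ext j
  rw [← hh', hh'', hc, mul_zero]
  rfl

theorem exists_denominator_ne_zero : ∃ k, P.denominator α k ≠ 0 := by
  obtain ⟨k, hk⟩ := P.exists_gen_ne_one α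
  refine ⟨k, fun h => hk ?_⟩
  rw [denominator_eq, sub_eq_zero, alphaHom_apply, ← LaurentPolynomial.T_zero] at h
  exact Multiplicative.toAdd.injective (LaurentPolynomial.T_injective h)

/-- Modulo `t - 1` every `α(x_j)` is `1`. Conversely, modulo all `α(x_j) - 1` the map `α` becomes
trivial on `G`, and `t` is one of its values. -/
theorem span_denominator :
    Ideal.span (Set.range (P.denominator α)) = Ideal.span {LaurentPolynomial.T 1 - 1} := by
  apply le_antisymm
  · rw [Ideal.span_le]
    rintro _ ⟨k, rfl⟩
    rw [denominator_eq, alphaHom_apply, SetLike.mem_coe, ← Ideal.Quotient.eq_zero_iff_mem]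
    set I : Ideal ℤ[T;T⁻¹] := Ideal.span {LaurentPolynomial.T 1 - 1}
    let θ : Multiplicative ℤ →* ℤ[T;T⁻¹] ⧸ I :=
      (Ideal.Quotient.mk I).toMonoidHom.comp (AddMonoidAlgebra.of ℤ ℤ)
    have hθ : θ = 1 := by
      refine MonoidHom.ext_mint ?_
      exact Ideal.Quotient.eq.2 (Ideal.mem_span_singleton_self _)
    rw [map_sub, map_one, sub_eq_zero]
    exact DFunLike.congr_fun hθ (α (Abelianization.of (P.gen k)))
  · rw [Ideal.span_le, Set.singleton_subset_iff, SetLike.mem_coe]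
    set I : Ideal ℤ[T;T⁻¹] := Ideal.span (Set.range (P.denominator α))
    have hF : ((Ideal.Quotient.mk I).toMonoidHom.comp (alphaHom α)).comp (FreeGroup.lift P.gen) =
        1 := by
      ext j
      rw [MonoidHom.comp_apply, FreeGroup.lift_apply_of]
      exact Ideal.Quotient.eq.2 (Ideal.subset_span ⟨j, rfl⟩)
    obtain ⟨g, hg⟩ := QuotientGroup.mk_surjective (α.symm (Multiplicative.ofAdd 1))
    obtain ⟨w, rfl⟩ := P.lift_surjective g
    have := DFunLike.congr_fun hF w
    rw [← Ideal.Quotient.eq, map_one]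
    have hT : alphaHom α (FreeGroup.lift P.gen w) = LaurentPolynomial.T 1 := by
      rw [alphaHom_apply, show Abelianization.of (FreeGroup.lift P.gen w) = _ from hg,
        α.apply_symm_apply]
      rfl
    rw [← hT]
    exact this

/-- The deficiency bound turns `min m (n - 1)` into `n - 1`; minors with repeated indices vanish and
reordering only changes signs, so the common divisors agree. -/
theorem isAlexanderGCD_iff (k : Fin P.n) (Q : ℤ[T;T⁻¹]) : P.IsAlexanderGCD α k Q ↔
    IsSetGCD (minorsAvoiding (P.n - 1) (P.alexanderMatrix α) k) Q := by
  have hN : min P.m (P.n - 1) = P.n - 1 := min_eq_right (by have := P.n_le_m_add_one α; omega)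
  have key : ∀ E, (∀ D ∈ P.maximalMinors α k, E ∣ D) ↔
      ∀ D ∈ minorsAvoiding (P.n - 1) (P.alexanderMatrix α) k, E ∣ D := by
    intro E
    rw [maximalMinors, hN]
    constructor
    · rintro h _ ⟨r, c, hc, rfl⟩
      by_cases hri : Function.Injective r
      swap
      · simp [minor_eq_zero_of_not_injective_rows _ r c hri]
      by_cases hci : Function.Injective c
      swap
      · simp [minor_eq_zero_of_not_injective_cols _ r c hci]
      obtain ⟨r', σ, hr⟩ := exists_orderEmbedding_comp_perm r hri
      obtain ⟨c', τ, hc'⟩ := exists_orderEmbedding_comp_perm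
        (fun p => (⟨c p, hc p⟩ : {j : Fin P.n // j ≠ k})) fun p q hpq =>
          hci (congrArg Subtype.val hpq)
      have : minor (P.alexanderMatrix α) r c =
          ((((P.alexanderMatrixRemove α k).submatrix r' c').submatrix id τ).submatrix σ id).det := by
        rw [minor]
        congr 1
        ext i j
        have := congrArg Subtype.val (congrFun hc' j)
        simp only [Function.comp_apply] at this
        simp [alexanderMatrixRemove, hr, this]
      rw [this, Matrix.det_permute, Matrix.det_permute']
      exact ((h _ ⟨r', c', rfl⟩).mul_left _).mul_left _
    · rintro h _ ⟨r, c, rfl⟩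
      exact h _ ⟨r, fun p => c p, fun p => (c p).2, rfl⟩
  simp only [IsAlexanderGCD, IsSetGCD, key]

theorem exists_isAlexanderGCD (k : Fin P.n) : ∃ Q, P.IsAlexanderGCD α k Q := by
  simp only [isAlexanderGCD_iff]
  refine exists_isSetGCD (Set.Finite.subset (Set.finite_range fun x : (Fin (P.n - 1) → Fin P.m) ×
    (Fin (P.n - 1) → Fin P.n) => minor (P.alexanderMatrix α) x.1 x.2) ?_)
  rintro _ ⟨r, c, -, rfl⟩
  exact ⟨(r, c), rfl⟩

/-- `Q_k / (α_*(x_k) - 1)` is, up to a unit, the quotient of the greatest common divisor of all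
`(n - 1) × (n - 1)` minors by `t - 1`. -/
theorem associated_alexanderGCD (k : Fin P.n) {Q Δ : ℤ[T;T⁻¹]} (hQ : P.IsAlexanderGCD α k Q)
    (hΔ : IsSetGCD (minorsIdeal (P.n - 1) (P.alexanderRelations α) : Set ℤ[T;T⁻¹]) Δ) :
    Associated (Q * (LaurentPolynomial.T 1 - 1)) (Δ * P.denominator α k) :=
  associated_mul_gcd (by rw [Fintype.card_fin]; have := k.pos; omega) _ (P.denominator α)
    (P.sum_alexanderMatrix_mul_denominator α) (P.span_denominator α) k
    ((P.isAlexanderGCD_iff α k Q).1 hQ) hΔ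

theorem exists_isSetGCD_minorsIdeal :
    ∃ Δ, IsSetGCD (minorsIdeal (P.n - 1) (P.alexanderRelations α) : Set ℤ[T;T⁻¹]) Δ := by
  rw [alexanderRelations, minorsIdeal_span_range]
  simp only [isSetGCD_span_iff]
  exact exists_isSetGCD (Set.finite_range _)

theorem eqUpToUnit_rationalExpression (P' : FinitePresentation G) (k : Fin P.n) (k' : Fin P'.n)
    {Q Q' : ℤ[T;T⁻¹]} (hk : P.denominator α k ≠ 0) (hk' : P'.denominator α k' ≠ 0)
    (hQ : P.IsAlexanderGCD α k Q) (hQ' : P'.IsAlexanderGCD α k' Q') :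
    EqUpToUnit (P.rationalExpression α k Q) (P'.rationalExpression α k' Q') := by
  obtain ⟨Δ, hΔ⟩ := P.exists_isSetGCD_minorsIdeal α
  have h := P.associated_alexanderGCD α k hQ hΔ
  rw [P.minorsIdeal_alexanderRelations_eq α P' k.pos k'.pos] at hΔ
  have h' := P'.associated_alexanderGCD α k' hQ' hΔ
  have ht : (LaurentPolynomial.T 1 - 1 : ℤ[T;T⁻¹]) ≠ 0 := by
    rw [sub_ne_zero, ← LaurentPolynomial.T_zero]
    exact fun h => one_ne_zero (LaurentPolynomial.T_injective h)
  -- Both sides times `t - 1` are associated to `Δ` times the two denominators. Only `t - 1` is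
  -- cancelled, so `Δ` may be zero.
  have h1 : Associated (Q * P'.denominator α k') (Q' * P.denominator α k) := by
    refine Associated.of_mul_right (b := LaurentPolynomial.T 1 - 1) (d := LaurentPolynomial.T 1 - 1)
      ?_ (Associated.refl _) ht
    have e := (h.mul_right (P'.denominator α k')).trans
      ((Associated.of_eq (mul_right_comm _ _ _)).trans (h'.symm.mul_right (P.denominator α k)))
    rwa [mul_right_comm, mul_right_comm Q'] at e
  obtain ⟨u, hu⟩ := h1.symm
  obtain ⟨ε, s, hus⟩ := LaurentPolynomial.exists_eq_C_mul_T_of_isUnit _ u.isUnit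
  refine ⟨ε, s, ?_⟩
  have hinj := IsFractionRing.injective ℤ[T;T⁻¹] (FractionRing ℤ[T;T⁻¹])
  have hm : ∀ {x : ℤ[T;T⁻¹]}, x ≠ 0 → algebraMap ℤ[T;T⁻¹] (FractionRing ℤ[T;T⁻¹]) x ≠ 0 :=
    fun hx => (map_ne_zero_iff _ hinj).2 hx
  rw [rationalExpression, rationalExpression, ← hus, mul_div_assoc', div_eq_div_iff (hm hk) (hm hk'),
    ← map_mul, ← map_mul, ← map_mul, ← hu]
  congr 1
  ring

/-! ### Transport of presentations along group isomorphisms. -/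

theorem lift_symm_comp_gen {H : Type*} [Group H] (P : FinitePresentation H) (φ : G ≃* H) :
    FreeGroup.lift (fun j => φ.symm (P.gen j)) =
      φ.symm.toMonoidHom.comp (FreeGroup.lift P.gen) := by
  ext j
  simp

/-- The presentation of an isomorphic group. -/
def congr {H : Type*} [Group H] (P : FinitePresentation H) (φ : G ≃* H) : FinitePresentation G where
  n := P.n
  m := P.m
  gen j := φ.symm (P.gen j)
  rel := P.rel
  lift_surjective := by
    rw [lift_symm_comp_gen]
    exact φ.symm.surjective.comp P.lift_surjective
  ker_lift := by
    rw [lift_symm_comp_gen, ← P.ker_lift]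
    ext w
    simp [MonoidHom.mem_ker]

/-- The relators are unchanged by transport, so compatibility of `α` and `β` on generators makes the
two Alexander matrices literally equal. -/
theorem alphaStar_proj_congr {H : Type*} [Group H] (P : FinitePresentation H) (φ : G ≃* H)
    (β : Abelianization H ≃* Multiplicative ℤ)
    (h : ∀ g, β (Abelianization.of (φ g)) = α (Abelianization.of g))
    (x : MonoidAlgebra ℤ (FreeGroup (Fin P.n))) :
    alphaStar α ((P.congr φ).proj x) = alphaStar β (P.proj x) := by
  have hf : (alphaStar α).comp (P.congr φ).proj = (alphaStar β).comp P.proj := by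
    refine MonoidAlgebra.ringHom_ext' ?_ ?_
    · exact RingHom.ext_int _ _
    · refine FreeGroup.ext_hom _ _ fun j => ?_
      refine ((P.congr φ).alphaStar_proj_of α (FreeGroup.of j)).trans
        (Eq.trans ?_ (P.alphaStar_proj_of β (FreeGroup.of j)).symm)
      have e : (φ (FreeGroup.lift (P.congr φ).gen (FreeGroup.of j)) : H) =
          FreeGroup.lift P.gen (FreeGroup.of (α := Fin P.n) j) := by
        refine (congrArg φ FreeGroup.lift_apply_of).trans (Eq.trans ?_ FreeGroup.lift_apply_of.symm)
        exact φ.apply_symm_apply _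
      rw [alphaHom_apply, alphaHom_apply, ← h, e]
  exact DFunLike.congr_fun hf x

theorem alexanderMatrix_congr {H : Type*} [Group H] (P : FinitePresentation H) (φ : G ≃* H)
    (β : Abelianization H ≃* Multiplicative ℤ)
    (h : ∀ g, β (Abelianization.of (φ g)) = α (Abelianization.of g)) :
    (P.congr φ).alexanderMatrix α = P.alexanderMatrix β := by
  ext1 i j
  exact alphaStar_proj_congr α P φ β h _

theorem denominator_congr {H : Type*} [Group H] (P : FinitePresentation H) (φ : G ≃* H)
    (β : Abelianization H ≃* Multiplicative ℤ)
    (h : ∀ g, β (Abelianization.of (φ g)) = α (Abelianization.of g)) (k : Fin P.n) :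
    (P.congr φ).denominator α k = P.denominator β k := by
  change alphaHom α (φ.symm (P.gen k)) - 1 = alphaHom β (P.gen k) - 1
  rw [alphaHom_apply, alphaHom_apply, ← h, φ.apply_symm_apply]

theorem isAlexanderGCD_congr {H : Type*} [Group H] (P : FinitePresentation H) (φ : G ≃* H)
    (β : Abelianization H ≃* Multiplicative ℤ)
    (h : ∀ g, β (Abelianization.of (φ g)) = α (Abelianization.of g)) (k : Fin P.n)
    (Q : ℤ[T;T⁻¹]) : (P.congr φ).IsAlexanderGCD α k Q ↔ P.IsAlexanderGCD β k Q := by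
  have hmin : (P.congr φ).maximalMinors α k = P.maximalMinors β k := by
    unfold maximalMinors alexanderMatrixRemove
    rw [alexanderMatrix_congr α P φ β h]
    rfl
  unfold IsAlexanderGCD
  rw [hmin]

theorem rationalExpression_congr {H : Type*} [Group H] (P : FinitePresentation H) (φ : G ≃* H)
    (β : Abelianization H ≃* Multiplicative ℤ)
    (h : ∀ g, β (Abelianization.of (φ g)) = α (Abelianization.of g)) (k : Fin P.n)
    (Q : ℤ[T;T⁻¹]) :
    (P.congr φ).rationalExpression α k Q = P.rationalExpression β k Q := by
  unfold rationalExpression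
  rw [denominator_congr α P φ β h]

end FinitePresentation
end

theorem mainTheorem3 (K : Set ThreeSphere) (hK : IsKnot K) (x₀ : (Kᶜ : Set ThreeSphere))
    (α : Abelianization (KnotGroup K x₀) ≃* Multiplicative ℤ) :
    -- the rational expression makes sense for every finite presentation
    (∀ P : FinitePresentation (KnotGroup K x₀),
      (∃ k : Fin P.n, P.denominator α k ≠ 0) ∧
        ∀ k : Fin P.n, ∃ Q : ℤ[T;T⁻¹], P.IsAlexanderGCD α k Q) ∧
    -- it does not depend on the finite presentation, nor on `k`
    (∀ (P P' : FinitePresentation (KnotGroup K x₀)) (k : Fin P.n) (k' : Fin P'.n)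
      (Q Q' : ℤ[T;T⁻¹]),
      P.denominator α k ≠ 0 → P'.denominator α k' ≠ 0 →
      P.IsAlexanderGCD α k Q → P'.IsAlexanderGCD α k' Q' →
      EqUpToUnit (P.rationalExpression α k Q) (P'.rationalExpression α k' Q')) ∧
    -- it is an invariant of the group with its identification `α`
    (∀ (H : Type*) [Group H] (β : Abelianization H ≃* Multiplicative ℤ) (φ : KnotGroup K x₀ ≃* H),
      (∀ g : KnotGroup K x₀, β (Abelianization.of (φ g)) = α (Abelianization.of g)) →
      ∀ (P : FinitePresentation (KnotGroup K x₀)) (P' : FinitePresentation H)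
        (k : Fin P.n) (k' : Fin P'.n) (Q Q' : ℤ[T;T⁻¹]),
        P.denominator α k ≠ 0 → P'.denominator β k' ≠ 0 →
        P.IsAlexanderGCD α k Q → P'.IsAlexanderGCD β k' Q' →
        EqUpToUnit (P.rationalExpression α k Q) (P'.rationalExpression β k' Q')) := by
  refine ⟨fun P => ⟨P.exists_denominator_ne_zero α, P.exists_isAlexanderGCD α⟩,
    fun P P' k k' Q Q' hk hk' hQ hQ' => P.eqUpToUnit_rationalExpression α P' k k' hk hk' hQ hQ', ?_⟩
  intro H _ β φ h P P' k k' Q Q' hk hk' hQ hQ'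
  rw [← FinitePresentation.denominator_congr α P' φ β h] at hk'
  rw [← FinitePresentation.isAlexanderGCD_congr α P' φ β h] at hQ'
  rw [← FinitePresentation.rationalExpression_congr α P' φ β h]
  exact P.eqUpToUnit_rationalExpression α (P'.congr φ) k k' hk hk' hQ hQ'
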